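/- Let $A_1$, $A_2$ and $J$ be finite sets, each with at least two elements. Let $H=\bigcup_{t\ge 0}(A_1\times A_2)^t$ be the set of finite histories and $H^\infty=(A_1\times A_2)^{\mathbb N}$ the set of infinite histories, with the product $\sigma$-algebra; let $\mathcal F^t$ be the $\sigma$-algebra on $H^\infty$ generated by the first $t$ entries, $t\ge 0$. A strategy of coordinate $i\in\{1,2\}$ is a function $\sigma_i:H\to\Delta(A_i)$, where $\Delta(A_i)$ is the set of probability distributions on $A_i$; it is stationary if it is constant. A pair of strategies $(\sigma_1,\sigma_2)$ defines a probability measure $\mathbb P_{\sigma_1,\sigma_2}$ on $H^\infty$: after each finite history $h$ the next pair of letters is drawn from $\sigma_1(h)\otimes\sigma_2(h)$. Let $\sigma_1$ and $\sigma_2$ be stationary strategies that select every element of $A_1$, respectively $A_2$, with positive probability, let $\nu$ be any probability distribution on $J$, and let $\varepsilon>0$. Then there are a stopping time $\tau$ for the filtration $(\mathcal F^t)_{t\ge0}$ and an $\mathcal F^\tau$-measurable function $f:H^\infty\to J$ such that 1. there is $T\in\mathbb N$ with $\mathbb P_{\sigma_1',\sigma_2'}(\tau\le T)=1$ for every pair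 of strategies $(\sigma_1',\sigma_2')$; 2. for every strategy $\sigma_1'$ of coordinate 1 and every strategy $\sigma_2'$ of coordinate 2, $$\max_{j\in J}\bigl|\mathbb P_{\sigma_1',\sigma_2}(f=j)-\nu(j)\bigr|\le\varepsilon\quad\text{and}\quad \max_{j\in J}\bigl|\mathbb P_{\sigma_1,\sigma_2'}(f=j)-\nu(j)\bigr|\le\varepsilon .$$ -/

import Mathlib

open MeasureTheory ProbabilityTheory

namespace ControlledLottery

/-- Infinite histories. The entry with index `k` is the pair of letters `a ^ (k + 1)` that is chosen
in the `k + 1`-st stage; the space carries the product sigma-algebra. -/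
abbrev InfHistory (A₁ A₂ : Type*) := ℕ → A₁ × A₂

/-- Finite histories of length `t`. -/
abbrev FinHistory (A₁ A₂ : Type*) (t : ℕ) := Fin t → A₁ × A₂

/-- A behavior strategy for a coordinate with alphabet `A`: it assigns a distribution
over `A` to each finite history. -/
abbrev Strategy (A₁ A₂ A : Type*) := (t : ℕ) → FinHistory A₁ A₂ t → PMF A

/-- The strategy is stationary: the selected distribution does not depend on the history. -/
def Strategy.IsStationary {A₁ A₂ A : Type*} (σ : Strategy A₁ A₂ A) : Prop :=
  ∃ p : PMF A, ∀ (t : ℕ) (h : FinHistory A₁ A₂ t), σ t h = p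

/-- The strategy selects every letter with positive probability after every finite history. -/
def Strategy.IsFullyMixed {A₁ A₂ A : Type*} (σ : Strategy A₁ A₂ A) : Prop :=
  ∀ (t : ℕ) (h : FinHistory A₁ A₂ t) (a : A), 0 < σ t h a

section

variable {A₁ A₂ : Type*} [MeasurableSpace A₁] [MeasurableSpace A₂]

/-- The law of the next pair of letters after the finite history `h`: the two coordinates
choose their letters independently of each other. -/
noncomputable def stageLaw (σ₁ : Strategy A₁ A₂ A₁) (σ₂ : Strategy A₁ A₂ A₂)
    (t : ℕ) (h : FinHistory A₁ A₂ t) : Measure (A₁ × A₂) :=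
  (σ₁ t h).toMeasure.prod (σ₂ t h).toMeasure

instance (σ₁ : Strategy A₁ A₂ A₁) (σ₂ : Strategy A₁ A₂ A₂)
    (t : ℕ) (h : FinHistory A₁ A₂ t) : IsProbabilityMeasure (stageLaw σ₁ σ₂ t h) := by
  unfold stageLaw
  infer_instance

/-- The sigma-algebra generated by the histories of length `t`, as a filtration over `t`. -/
def historyFiltration (A₁ A₂ : Type*) [MeasurableSpace A₁] [MeasurableSpace A₂] :
    Filtration ℕ (inferInstance : MeasurableSpace (InfHistory A₁ A₂)) where
  seq t := MeasurableSpace.comap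
    (fun (h : InfHistory A₁ A₂) (k : Fin t) => h k) inferInstance
  mono' := by
    intro s t hst
    have h1 : Measurable (fun (g : FinHistory A₁ A₂ t) (k : Fin s) => g (Fin.castLE hst k)) := by
      fun_prop
    rintro u ⟨v, hv, rfl⟩
    exact ⟨_, h1 hv, rfl⟩
  le' := by
    intro t
    apply Measurable.comap_le
    fun_prop

/-- A mechanism with values in `J`: a stopping time for the filtration of finite
histories and an outcome function that is measurable with respect to the sigma-algebra of the
stopping time. -/
structure Mechanism (A₁ A₂ J : Type*) [MeasurableSpace A₁] [MeasurableSpace A₂] where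
  τ : InfHistory A₁ A₂ → WithTop ℕ
  isStoppingTime : IsStoppingTime (historyFiltration A₁ A₂) τ
  f : InfHistory A₁ A₂ → J
  measurable_f : Measurable[isStoppingTime.measurableSpace, ⊤] f

variable [Finite A₁] [Finite A₂] [MeasurableSingletonClass A₁] [MeasurableSingletonClass A₂]

/-- The transition kernel from the first `n + 1` stages to the next stage. -/
noncomputable def stageKernel (σ₁ : Strategy A₁ A₂ A₁) (σ₂ : Strategy A₁ A₂ A₂) (n : ℕ) :
    Kernel ((_ : Finset.Iic n) → A₁ × A₂) (A₁ × A₂) :=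
  Kernel.ofFunOfCountable fun h => stageLaw σ₁ σ₂ (n + 1)
    fun k => h ⟨k, Finset.mem_Iic.2 (Nat.lt_succ_iff.1 k.isLt)⟩

instance (σ₁ : Strategy A₁ A₂ A₁) (σ₂ : Strategy A₁ A₂ A₂) (n : ℕ) :
    IsMarkovKernel (stageKernel σ₁ σ₂ n) :=
  ⟨fun h => inferInstanceAs (IsProbabilityMeasure (stageLaw σ₁ σ₂ (n + 1)
    fun k => h ⟨k, Finset.mem_Iic.2 (Nat.lt_succ_iff.1 k.isLt)⟩))⟩

/-- The probability measure on infinite histories that a pair of strategies defines. -/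
noncomputable def playMeasure (σ₁ : Strategy A₁ A₂ A₁) (σ₂ : Strategy A₁ A₂ A₂) :
    Measure (InfHistory A₁ A₂) :=
  Kernel.trajMeasure (X := fun _ => A₁ × A₂) (stageLaw σ₁ σ₂ 0 Fin.elim0) (stageKernel σ₁ σ₂)

/-- The probability that the mechanism selects `j` under a pair of strategies. -/
noncomputable def Mechanism.outcomeProb {J : Type*} (M : Mechanism A₁ A₂ J)
    (σ₁ : Strategy A₁ A₂ A₁) (σ₂ : Strategy A₁ A₂ A₂) (j : J) : ℝ :=
  (playMeasure σ₁ σ₂).real {h | M.f h = j}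

/-- The mechanism has length at most `T`. -/
def Mechanism.HasLengthAtMost {J : Type*} (M : Mechanism A₁ A₂ J) (T : ℕ) : Prop :=
  ∀ (σ₁ : Strategy A₁ A₂ A₁) (σ₂ : Strategy A₁ A₂ A₂),
    playMeasure σ₁ σ₂ {h | M.τ h ≤ (T : WithTop ℕ)} = 1

/-- The mechanism and the pair of strategies `ε`-implement `ν`; the norm on `J → ℝ` is
the sup-norm. -/
def Mechanism.Implements {J : Type*} [Fintype J] (M : Mechanism A₁ A₂ J)
    (σ₁ : Strategy A₁ A₂ A₁) (σ₂ : Strategy A₁ A₂ A₂) (ν : PMF J) (ε : ℝ) : Prop :=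
  ‖M.outcomeProb σ₁ σ₂ - fun j => (ν j).toReal‖ ≤ ε

/-- The mechanism and the pair of strategies `ε`-implement `ν` in a strong secure fashion:
`ν` is still `ε`-implemented when one of the coordinates changes its strategy arbitrarily. -/
def Mechanism.StronglyImplements {J : Type*} [Fintype J] (M : Mechanism A₁ A₂ J)
    (σ₁ : Strategy A₁ A₂ A₁) (σ₂ : Strategy A₁ A₂ A₂) (ν : PMF J) (ε : ℝ) : Prop :=
  (∀ σ₁' : Strategy A₁ A₂ A₁, M.Implements σ₁' σ₂ ν ε) ∧
    ∀ σ₂' : Strategy A₁ A₂ A₂, M.Implements σ₁ σ₂' ν ε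

end

end ControlledLottery

/-! The mechanism runs a martingale `X` on the simplex of distributions over `J`, starting at `ν`,
for a fixed number `T` of stages, and selects an outcome to which `X` then gives the largest weight.

Fix letters `a₀`, `b₀` and let `u`, `v` be the indicators of `{a₀}`, `{b₀}`, centred under the
prescribed laws. The shock `s = u * v` has mean zero in a stage as soon as one of the two
coordinates follows its prescribed law, whatever the other one does, because the two draws are
independent given the past; and full support makes `s ^ 2` bounded below by some `m > 0`. After the
letters `a`, the weight of `j` is multiplied by `1 + s a * (g j - ∑ k, X k * g k)`, where
`g : J → [0, 1]` is injective. This keeps `X` in the simplex, and makes it a martingale under every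
unilateral deviation (`integral_reweight`), so that the mean of `X` stays `ν`.

The shocks push `X` to the vertices. The impurity `1 - ∑ j, X j ^ 2` loses on average at least
`κ * impurity ^ 2` per stage (`integral_giniImpurity_reweight_le`), since the weights spread `g` as
long as they are not concentrated at one point (`giniImpurity_sq_le`). Hence its mean falls below
`ε` at a time that depends only on `κ` and `ε` (`exists_forall_le_of_sq_decrease`). The impurity
also bounds the distance from `X` to the vertex at its largest weight (`abs_indicator_sub_le`), so the
probability that `j` is selected differs from `ν j` by at most `ε`. -/

namespace ControlledLottery

open Finset

/-! ### Reweighting a distribution on a finite set -/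

section Reweight

variable {J : Type*} [Fintype J]

/-- The replicator step: the weight of `j` is multiplied by `1 + s * (g j - ḡ)`, where `ḡ` is the
mean of `g` under the weights `x`. -/
def reweight (g : J → ℝ) (x : J → ℝ) (s : ℝ) (j : J) : ℝ :=
  x j * (1 + s * (g j - ∑ k, x k * g k))

/-- The Gini impurity of the weights `x`; on the simplex it vanishes exactly at the vertices. -/
def giniImpurity (x : J → ℝ) : ℝ := 1 - ∑ j, x j ^ 2

lemma sum_mul_mem_Icc {g x : J → ℝ} (hg : ∀ j, g j ∈ Set.Icc (0 : ℝ) 1) (hx : x ∈ stdSimplex ℝ J) :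
    ∑ k, x k * g k ∈ Set.Icc (0 : ℝ) 1 := by
  refine ⟨sum_nonneg fun k _ => mul_nonneg (hx.1 k) (hg k).1, ?_⟩
  calc ∑ k, x k * g k ≤ ∑ k, x k :=
        sum_le_sum fun k _ => mul_le_of_le_one_right (hx.1 k) (hg k).2
    _ = 1 := hx.2

lemma abs_sub_sum_mul_le_one {g x : J → ℝ} (hg : ∀ j, g j ∈ Set.Icc (0 : ℝ) 1)
    (hx : x ∈ stdSimplex ℝ J) (j : J) : |g j - ∑ k, x k * g k| ≤ 1 := by
  have h1 := sum_mul_mem_Icc hg hx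
  have h2 := hg j
  rw [abs_le]
  constructor <;> linarith [h1.1, h1.2, h2.1, h2.2]

lemma sum_mul_sub_sum_mul {g x : J → ℝ} (hx : x ∈ stdSimplex ℝ J) :
    ∑ j, x j * (g j - ∑ k, x k * g k) = 0 := by
  simp only [mul_sub, sum_sub_distrib, ← sum_mul, hx.2, one_mul, sub_self]

lemma reweight_mem_stdSimplex {g x : J → ℝ} (hg : ∀ j, g j ∈ Set.Icc (0 : ℝ) 1)
    (hx : x ∈ stdSimplex ℝ J) {s : ℝ} (hs : |s| ≤ 1) : reweight g x s ∈ stdSimplex ℝ J := by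
  constructor
  · intro j
    refine mul_nonneg (hx.1 j) ?_
    have h : |s * (g j - ∑ k, x k * g k)| ≤ 1 := by
      rw [abs_mul]
      exact mul_le_one₀ hs (abs_nonneg _) (abs_sub_sum_mul_le_one hg hx j)
    linarith [(abs_le.1 h).1]
  · have h : ∀ j, reweight g x s j = x j + s * (x j * (g j - ∑ k, x k * g k)) := fun j => by
      unfold reweight; ring
    simp only [h, sum_add_distrib, ← mul_sum, sum_mul_sub_sum_mul hx, hx.2, mul_zero, add_zero]

lemma giniImpurity_reweight (g x : J → ℝ) (s : ℝ) :
    giniImpurity (reweight g x s) = giniImpurity x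
      - s * (2 * ∑ j, x j ^ 2 * (g j - ∑ k, x k * g k))
      - s ^ 2 * ∑ j, (x j * (g j - ∑ k, x k * g k)) ^ 2 := by
  have h : ∀ j, reweight g x s j ^ 2 = x j ^ 2 + s * (2 * (x j ^ 2 * (g j - ∑ k, x k * g k)))
      + s ^ 2 * (x j * (g j - ∑ k, x k * g k)) ^ 2 := fun j => by
    unfold reweight; ring
  simp only [giniImpurity, h, sum_add_distrib, ← mul_sum]
  ring

lemma giniImpurity_nonneg {x : J → ℝ} (hx : x ∈ stdSimplex ℝ J) : 0 ≤ giniImpurity x := by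
  have h : ∑ j, x j ^ 2 ≤ ∑ j, x j := sum_le_sum fun j _ => by
    have h1 : x j ≤ 1 := hx.2 ▸ single_le_sum (fun i _ => hx.1 i) (mem_univ j)
    nlinarith [hx.1 j]
  rw [hx.2] at h
  exact sub_nonneg.2 h

lemma giniImpurity_le_one (x : J → ℝ) : giniImpurity x ≤ 1 :=
  sub_le_self _ (sum_nonneg fun _ _ => sq_nonneg _)

/-- If the values of `g` are separated, the variance of `g` dominates the impurity: the variance is
half the mean of `(g i - g j) ^ 2` for independent `i`, `j`, and the impurity is the probability
that `i ≠ j`. -/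
lemma mul_giniImpurity_le_variance {g x : J → ℝ} {δ : ℝ}
    (hδ : ∀ i j, i ≠ j → δ ≤ (g i - g j) ^ 2) (hx : x ∈ stdSimplex ℝ J) :
    δ / 2 * giniImpurity x ≤ ∑ j, x j * (g j - ∑ k, x k * g k) ^ 2 := by
  classical
  set b := ∑ k, x k * g k with hb
  have e1 : ∑ j, x j * (g j - b) ^ 2 = ∑ j, x j * g j ^ 2 - b ^ 2 := by
    have h : ∀ j, x j * (g j - b) ^ 2 = x j * g j ^ 2 - 2 * b * (x j * g j) + b ^ 2 * x j :=
      fun j => by ring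
    simp only [h, sum_add_distrib, sum_sub_distrib, ← mul_sum, hx.2, ← hb]
    ring
  have e2 : ∑ i, ∑ j, x i * x j * (g i - g j) ^ 2 = 2 * (∑ j, x j * g j ^ 2 - b ^ 2) := by
    have h : ∀ i j, x i * x j * (g i - g j) ^ 2
        = (x i * g i ^ 2) * x j - 2 * ((x i * g i) * (x j * g j)) + x i * (x j * g j ^ 2) :=
      fun i j => by ring
    simp only [h, sum_add_distrib, sum_sub_distrib, ← mul_sum, ← sum_mul, hx.2, ← hb]
    ring
  have e3 : ∑ i, ∑ j, δ * (x i * x j - if i = j then x i * x j else 0) = δ * giniImpurity x := by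
    simp only [← mul_sum, sum_sub_distrib, sum_ite_eq, mem_univ, if_true, hx.2,
      giniImpurity, mul_one, pow_two]
  have e4 : ∑ i, ∑ j, δ * (x i * x j - if i = j then x i * x j else 0)
      ≤ ∑ i, ∑ j, x i * x j * (g i - g j) ^ 2 := by
    refine sum_le_sum fun i _ => sum_le_sum fun j _ => ?_
    by_cases hij : i = j
    · simp [hij]
    · simp only [hij, if_false, sub_zero]
      rw [mul_comm]
      exact mul_le_mul_of_nonneg_left (hδ i j hij) (mul_nonneg (hx.1 i) (hx.1 j))
  linarith

/-- The mean square displacement of a reweighting step is at least quadratic in the impurity. -/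
lemma giniImpurity_sq_le {g x : J → ℝ} {δ : ℝ} (hδ0 : 0 ≤ δ)
    (hg : ∀ j, g j ∈ Set.Icc (0 : ℝ) 1)
    (hδ : ∀ i j, i ≠ j → δ ≤ (g i - g j) ^ 2) (hx : x ∈ stdSimplex ℝ J) :
    (δ / 2 * giniImpurity x) ^ 2
      ≤ Fintype.card J * ∑ j, (x j * (g j - ∑ k, x k * g k)) ^ 2 := by
  have h0 : 0 ≤ δ / 2 * giniImpurity x := mul_nonneg (by linarith) (giniImpurity_nonneg hx)
  calc (δ / 2 * giniImpurity x) ^ 2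
      ≤ (∑ j, x j * (g j - ∑ k, x k * g k) ^ 2) ^ 2 :=
        pow_le_pow_left₀ h0 (mul_giniImpurity_le_variance hδ hx) 2
    _ ≤ Fintype.card J * ∑ j, (x j * (g j - ∑ k, x k * g k) ^ 2) ^ 2 := sq_sum_le_card_mul_sum_sq
    _ ≤ Fintype.card J * ∑ j, (x j * (g j - ∑ k, x k * g k)) ^ 2 := by
        refine mul_le_mul_of_nonneg_left (sum_le_sum fun j _ => ?_) (Nat.cast_nonneg _)
        have h1 : (g j - ∑ k, x k * g k) ^ 2 ≤ 1 :=
          (sq_le_one_iff_abs_le_one _).2 (abs_sub_sum_mul_le_one hg hx j)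
        have h2 : 0 ≤ (x j * (g j - ∑ k, x k * g k)) ^ 2 := sq_nonneg _
        calc (x j * (g j - ∑ k, x k * g k) ^ 2) ^ 2
            = (x j * (g j - ∑ k, x k * g k)) ^ 2 * (g j - ∑ k, x k * g k) ^ 2 := by ring
          _ ≤ (x j * (g j - ∑ k, x k * g k)) ^ 2 := mul_le_of_le_one_right h2 h1

/-- Each coordinate of the vertex at a largest weight is within the impurity of the weights. -/
lemma abs_indicator_sub_le {x : J → ℝ} (hx : x ∈ stdSimplex ℝ J) {i : J} (hi : ∀ k, x k ≤ x i)
    (j : J) : |Set.indicator {j} (1 : J → ℝ) i - x j| ≤ giniImpurity x := by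
  classical
  have h1 : ∑ k, x k ^ 2 ≤ x i := by
    calc ∑ k, x k ^ 2 ≤ ∑ k, x k * x i := sum_le_sum fun k _ => by
          rw [pow_two]; exact mul_le_mul_of_nonneg_left (hi k) (hx.1 k)
      _ = x i := by rw [← sum_mul, hx.2, one_mul]
  have h2 : ∀ k, x k ≤ 1 := fun k => hx.2 ▸ single_le_sum (fun i _ => hx.1 i) (mem_univ k)
  unfold giniImpurity
  by_cases hij : i = j
  · subst hij
    rw [Set.indicator_of_mem (Set.mem_singleton i), Pi.one_apply,
      abs_of_nonneg (sub_nonneg.2 (h2 i))]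
    linarith
  · rw [Set.indicator_of_notMem (by simpa using hij), zero_sub, abs_neg, abs_of_nonneg (hx.1 j)]
    have h3 : ∑ k ∈ {i, j}, x k ≤ ∑ k, x k :=
      sum_le_sum_of_subset_of_nonneg (subset_univ _) fun k _ _ => hx.1 k
    rw [sum_pair hij, hx.2] at h3
    linarith

lemma exists_separated_Icc (J : Type*) [Finite J] : ∃ (g : J → ℝ) (δ : ℝ), 0 < δ ∧
    (∀ j, g j ∈ Set.Icc (0 : ℝ) 1) ∧ ∀ i j, i ≠ j → δ ≤ (g i - g j) ^ 2 := by
  obtain ⟨n, ⟨e⟩⟩ := Finite.exists_equiv_fin J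
  have hn : (0 : ℝ) < n + 1 := by positivity
  refine ⟨fun j => (e j : ℝ) / (n + 1), (1 / (n + 1)) ^ 2, by positivity,
    fun j => ⟨by positivity, ?_⟩, fun i j hij => ?_⟩
  · rw [div_le_one hn]
    have : ((e j : ℕ) : ℝ) ≤ n := by exact_mod_cast (e j).isLt.le
    linarith
  · rw [← sub_div, div_pow, div_pow]
    refine div_le_div_of_nonneg_right ?_ (by positivity)
    have h : ((e i : ℕ) : ℤ) - (e j : ℕ) ≠ 0 := by
      intro h
      exact hij (e.injective (Fin.ext (by omega)))
    have h2 : (1 : ℤ) ≤ |((e i : ℕ) : ℤ) - (e j : ℕ)| := Int.one_le_abs h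
    have h3 : (1 : ℤ) ^ 2 ≤ (((e i : ℕ) : ℤ) - (e j : ℕ)) ^ 2 := by
      rw [← sq_abs (((e i : ℕ) : ℤ) - (e j : ℕ))]
      exact pow_le_pow_left₀ zero_le_one h2 2
    exact_mod_cast h3

end Reweight

/-! ### One stage with a mean-zero shock -/

section OneStage

variable {J Ω : Type*} [Fintype J] [Finite Ω] [MeasurableSpace Ω] [MeasurableSingletonClass Ω]
  {μ : Measure Ω} [IsProbabilityMeasure μ] {s : Ω → ℝ}

lemma integral_reweight (hs : ∫ a, s a ∂μ = 0) (g x : J → ℝ) (j : J) :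
    ∫ a, reweight g x (s a) j ∂μ = x j := by
  have h : ∀ a, reweight g x (s a) j = x j + s a * (x j * (g j - ∑ k, x k * g k)) := fun a => by
    unfold reweight; ring
  simp only [h]
  rw [integral_add .of_finite .of_finite, integral_mul_const, hs]
  simp

lemma integral_giniImpurity_reweight_le (hs : ∫ a, s a ∂μ = 0) {m : ℝ}
    (hm : ∀ a, m ≤ s a ^ 2) (hm0 : 0 ≤ m) [Nonempty J] {g x : J → ℝ} {δ : ℝ} (hδ0 : 0 ≤ δ)
    (hg : ∀ j, g j ∈ Set.Icc (0 : ℝ) 1)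
    (hδ : ∀ i j, i ≠ j → δ ≤ (g i - g j) ^ 2) (hx : x ∈ stdSimplex ℝ J) :
    ∫ a, giniImpurity (reweight g x (s a)) ∂μ
      ≤ giniImpurity x - m * (δ / 2) ^ 2 / Fintype.card J * giniImpurity x ^ 2 := by
  have hc : (0 : ℝ) < Fintype.card J := by exact_mod_cast Fintype.card_pos
  set V := ∑ j, (x j * (g j - ∑ k, x k * g k)) ^ 2 with hV
  have hV0 : 0 ≤ V := sum_nonneg fun _ _ => sq_nonneg _
  have h1 : m * (δ / 2) ^ 2 / Fintype.card J * giniImpurity x ^ 2 ≤ m * V := by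
    have h := mul_le_mul_of_nonneg_left (giniImpurity_sq_le hδ0 hg hδ hx) hm0
    rw [div_mul_eq_mul_div, div_le_iff₀ hc]
    linarith
  have h2 : ∀ a, giniImpurity (reweight g x (s a)) ≤ (giniImpurity x - m * V)
      - s a * (2 * ∑ j, x j ^ 2 * (g j - ∑ k, x k * g k)) := fun a => by
    rw [giniImpurity_reweight, ← hV]
    have h := mul_le_mul_of_nonneg_right (hm a) hV0
    linarith
  calc ∫ a, giniImpurity (reweight g x (s a)) ∂μ
      ≤ ∫ a, ((giniImpurity x - m * V)
          - s a * (2 * ∑ j, x j ^ 2 * (g j - ∑ k, x k * g k))) ∂μ :=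
        integral_mono .of_finite .of_finite h2
    _ = giniImpurity x - m * V := by
        rw [integral_sub .of_finite .of_finite, integral_mul_const, hs]
        simp
    _ ≤ _ := by linarith

end OneStage

/-- Sequences in `[0, 1]` that decrease by at least `κ` times their square become small at a time
that does not depend on the sequence. -/
lemma exists_forall_le_of_sq_decrease {κ ε : ℝ} (hκ : 0 < κ) (hε : 0 < ε) :
    ∃ T : ℕ, ∀ w : ℕ → ℝ, w 0 ≤ 1 → (∀ t, w (t + 1) ≤ w t - κ * w t ^ 2) → w T ≤ ε := by
  have hκε : 0 < κ * ε ^ 2 := by positivity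
  obtain ⟨T, hT⟩ := exists_nat_ge (1 / (κ * ε ^ 2))
  refine ⟨T, fun w h0 hw => ?_⟩
  have key : ∀ t : ℕ, w t ≤ max ε (1 - t * (κ * ε ^ 2)) := by
    intro t
    induction t with
    | zero => simp [h0]
    | succ t ih =>
      rcases le_or_gt (w t) ε with h | h
      · refine le_max_of_le_left ((hw t).trans ?_)
        have : 0 ≤ κ * w t ^ 2 := by positivity
        linarith
      · have h1 : w t ≤ 1 - t * (κ * ε ^ 2) := (le_max_iff.1 ih).resolve_left h.not_ge
        have h2 : κ * ε ^ 2 ≤ κ * w t ^ 2 := by gcongr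
        refine le_max_of_le_right ((hw t).trans ?_)
        push_cast
        linarith
  rw [div_le_iff₀ hκε] at hT
  exact (key T).trans (max_le le_rfl (by linarith))

/-! ### The play measure, stage by stage -/

section Play

variable {A₁ A₂ : Type*} [MeasurableSpace A₁] [MeasurableSpace A₂]

/-- The first `t` entries of an infinite history. -/
def truncate (t : ℕ) (x : InfHistory A₁ A₂) : FinHistory A₁ A₂ t := fun k => x k

lemma measurable_truncate (t : ℕ) : Measurable (truncate (A₁ := A₁) (A₂ := A₂) t) := by
  unfold truncate
  fun_prop

variable [Finite A₁] [Finite A₂] [MeasurableSingletonClass A₁] [MeasurableSingletonClass A₂]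
  (σ₁ : Strategy A₁ A₂ A₁) (σ₂ : Strategy A₁ A₂ A₂)

instance : IsProbabilityMeasure (playMeasure σ₁ σ₂) := by
  unfold playMeasure
  infer_instance

lemma integrable_truncate {E : Type*} [NormedAddCommGroup E] {t : ℕ}
    (φ : FinHistory A₁ A₂ t → E) :
    Integrable (fun x => φ (truncate t x)) (playMeasure σ₁ σ₂) :=
  Integrable.comp_measurable (g := φ) .of_finite (measurable_truncate t)

lemma map_eval_zero_playMeasure :
    (playMeasure σ₁ σ₂).map (fun x => x 0) = stageLaw σ₁ σ₂ 0 Fin.elim0 := by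
  have h : (fun x : InfHistory A₁ A₂ => x 0)
      = MeasurableEquiv.piUnique (fun _ : Finset.Iic 0 => A₁ × A₂)
        ∘ Preorder.frestrictLe (π := fun _ : ℕ => A₁ × A₂) 0 := by
    funext x
    rfl
  have hm : Measurable (Preorder.frestrictLe (π := fun _ : ℕ => A₁ × A₂) 0) :=
    Preorder.measurable_frestrictLe 0
  rw [h, ← Measure.map_map (MeasurableEquiv.measurable _) hm, playMeasure, Kernel.trajMeasure,
    Measure.map_comp _ _ hm, Kernel.traj_map_frestrictLe, Kernel.partialTraj_self,
    Measure.id_comp]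
  exact MeasurableEquiv.map_map_symm _

/-- Given the first `t` stages, the next pair of letters has the stage law. -/
lemma integral_playMeasure_stage (t : ℕ) (φ : FinHistory A₁ A₂ t → A₁ × A₂ → ℝ) :
    ∫ x, φ (truncate t x) (x t) ∂(playMeasure σ₁ σ₂)
      = ∫ x, ∫ a, φ (truncate t x) a ∂(stageLaw σ₁ σ₂ t (truncate t x)) ∂(playMeasure σ₁ σ₂) := by
  cases t with
  | zero =>
    have h : ∀ x : InfHistory A₁ A₂, truncate 0 x = Fin.elim0 := fun x => Subsingleton.elim _ _
    simp only [h, integral_const, probReal_univ, one_smul]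
    rw [← map_eval_zero_playMeasure σ₁ σ₂, integral_map (measurable_pi_apply 0).aemeasurable
      Measurable.of_discrete.aestronglyMeasurable]
  | succ n =>
    -- Read a history indexed by `Finset.Iic n` as one of length `n + 1`.
    set ψ : ((_ : Finset.Iic n) → A₁ × A₂) → FinHistory A₁ A₂ (n + 1) :=
      fun h k => h ⟨k, Finset.mem_Iic.2 (Nat.lt_succ_iff.1 k.isLt)⟩ with hψ
    have hm : Measurable (Preorder.frestrictLe (π := fun _ : ℕ => A₁ × A₂) n) :=
      Preorder.measurable_frestrictLe n
    have key := Kernel.map_frestrictLe_trajMeasure_compProd_eq_map_trajMeasure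
      (X := fun _ => A₁ × A₂) (μ₀ := stageLaw σ₁ σ₂ 0 Fin.elim0) (κ := stageKernel σ₁ σ₂) (a := n)
    change (playMeasure σ₁ σ₂).map _ ⊗ₘ _ = (playMeasure σ₁ σ₂).map _ at key
    have : IsProbabilityMeasure ((playMeasure σ₁ σ₂).map
        (Preorder.frestrictLe (π := fun _ : ℕ => A₁ × A₂) n)) :=
      Measure.isProbabilityMeasure_map hm.aemeasurable
    have h1 : ∫ x, φ (truncate (n + 1) x) (x (n + 1)) ∂(playMeasure σ₁ σ₂)
        = ∫ z, φ (ψ z.1) z.2 ∂((playMeasure σ₁ σ₂).map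
          (fun x => (Preorder.frestrictLe n x, x (n + 1)))) := by
      rw [integral_map (by fun_prop) (Measurable.of_discrete.aestronglyMeasurable)]
      rfl
    rw [h1, ← key, Measure.integral_compProd .of_finite,
      integral_map hm.aemeasurable (Measurable.of_discrete.aestronglyMeasurable)]
    rfl

end Play

/-! ### The martingale of weights -/

section Weights

variable {A₁ A₂ J : Type*} [Fintype J]

/-- The weights after a finite history: each stage with letters `a` reweights by the shock `s a`. -/
def weights (g : J → ℝ) (s : A₁ × A₂ → ℝ) (x₀ : J → ℝ) :
    (t : ℕ) → FinHistory A₁ A₂ t → J → ℝ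
  | 0, _ => x₀
  | t + 1, h => reweight g (weights g s x₀ t fun k => h k.castSucc) (s (h (Fin.last t)))

lemma weights_truncate_succ (g : J → ℝ) (s : A₁ × A₂ → ℝ) (x₀ : J → ℝ) (t : ℕ)
    (x : InfHistory A₁ A₂) : weights g s x₀ (t + 1) (truncate (t + 1) x)
      = reweight g (weights g s x₀ t (truncate t x)) (s (x t)) :=
  rfl

lemma weights_mem_stdSimplex {g x₀ : J → ℝ} {s : A₁ × A₂ → ℝ}
    (hg : ∀ j, g j ∈ Set.Icc (0 : ℝ) 1) (hs : ∀ a, |s a| ≤ 1) (hx₀ : x₀ ∈ stdSimplex ℝ J) :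
    ∀ (t : ℕ) (h : FinHistory A₁ A₂ t), weights g s x₀ t h ∈ stdSimplex ℝ J
  | 0, _ => hx₀
  | t + 1, _ => reweight_mem_stdSimplex hg (weights_mem_stdSimplex hg hs hx₀ t _) (hs _)

variable [MeasurableSpace A₁] [MeasurableSpace A₂]
  [Finite A₁] [Finite A₂] [MeasurableSingletonClass A₁] [MeasurableSingletonClass A₂]
  {σ₁ : Strategy A₁ A₂ A₁} {σ₂ : Strategy A₁ A₂ A₂} {g x₀ : J → ℝ} {s : A₁ × A₂ → ℝ}

lemma integral_weights (h0 : ∀ t h, ∫ a, s a ∂(stageLaw σ₁ σ₂ t h) = 0) (t : ℕ) (j : J) :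
    ∫ x, weights g s x₀ t (truncate t x) j ∂(playMeasure σ₁ σ₂) = x₀ j := by
  induction t with
  | zero => simp [weights]
  | succ t ih =>
    simp only [weights_truncate_succ]
    rw [integral_playMeasure_stage σ₁ σ₂ t (fun h a => reweight g (weights g s x₀ t h) (s a) j)]
    simp only [integral_reweight (h0 _ _), ih]

/-- By Jensen's inequality, the decrease of the impurity in one stage passes to its mean under the
play measure, with a rate that does not depend on the strategies. -/
lemma integral_giniImpurity_weights_succ_le [Nonempty J]
    (h0 : ∀ t h, ∫ a, s a ∂(stageLaw σ₁ σ₂ t h) = 0) (hs : ∀ a, |s a| ≤ 1) {m : ℝ}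
    (hm : ∀ a, m ≤ s a ^ 2) (hm0 : 0 ≤ m) {δ : ℝ} (hδ0 : 0 ≤ δ)
    (hg : ∀ j, g j ∈ Set.Icc (0 : ℝ) 1) (hδ : ∀ i j, i ≠ j → δ ≤ (g i - g j) ^ 2)
    (hx₀ : x₀ ∈ stdSimplex ℝ J) (t : ℕ) :
    ∫ x, giniImpurity (weights g s x₀ (t + 1) (truncate (t + 1) x)) ∂(playMeasure σ₁ σ₂)
      ≤ (∫ x, giniImpurity (weights g s x₀ t (truncate t x)) ∂(playMeasure σ₁ σ₂))
        - m * (δ / 2) ^ 2 / Fintype.card J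
          * (∫ x, giniImpurity (weights g s x₀ t (truncate t x)) ∂(playMeasure σ₁ σ₂)) ^ 2 := by
  set P := playMeasure σ₁ σ₂
  set κ := m * (δ / 2) ^ 2 / Fintype.card J with hκ
  set W : FinHistory A₁ A₂ t → ℝ := fun h => giniImpurity (weights g s x₀ t h)
  have hκ0 : 0 ≤ κ := by positivity
  have jensen : (∫ x, W (truncate t x) ∂P) ^ 2 ≤ ∫ x, W (truncate t x) ^ 2 ∂P :=
    (even_two.convexOn_pow (𝕜 := ℝ)).map_integral_le (continuous_pow 2).continuousOn isClosed_univ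
      (Filter.Eventually.of_forall fun _ => Set.mem_univ _) (integrable_truncate σ₁ σ₂ W)
      (integrable_truncate σ₁ σ₂ fun h => W h ^ 2)
  simp only [weights_truncate_succ]
  rw [integral_playMeasure_stage σ₁ σ₂ t
    (fun h a => giniImpurity (reweight g (weights g s x₀ t h) (s a)))]
  calc ∫ x, ∫ a, giniImpurity (reweight g (weights g s x₀ t (truncate t x)) (s a))
          ∂(stageLaw σ₁ σ₂ t (truncate t x)) ∂P
      ≤ ∫ x, (W (truncate t x) - κ * W (truncate t x) ^ 2) ∂P := by
        refine integral_mono (integrable_truncate σ₁ σ₂ fun h => ∫ a,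
          giniImpurity (reweight g (weights g s x₀ t h) (s a)) ∂(stageLaw σ₁ σ₂ t h))
          (integrable_truncate σ₁ σ₂ fun h => W h - κ * W h ^ 2) fun x => ?_
        exact integral_giniImpurity_reweight_le (h0 _ _) hm hm0 hδ0 hg hδ
          (weights_mem_stdSimplex hg hs hx₀ _ _)
    _ = (∫ x, W (truncate t x) ∂P) - κ * ∫ x, W (truncate t x) ^ 2 ∂P := by
        rw [integral_sub (integrable_truncate σ₁ σ₂ W)
          (integrable_truncate σ₁ σ₂ fun h => κ * W h ^ 2), integral_const_mul]
    _ ≤ _ := sub_le_sub_left (mul_le_mul_of_nonneg_left jensen hκ0) _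

end Weights

/-! ### The mechanism -/

/-- The mechanism that stops after exactly `T` stages and selects `F` of the history. -/
def fixedLengthMechanism {A₁ A₂ J : Type*} [MeasurableSpace A₁] [MeasurableSpace A₂]
    [Finite A₁] [Finite A₂] [MeasurableSingletonClass A₁] [MeasurableSingletonClass A₂]
    (T : ℕ) (F : FinHistory A₁ A₂ T → J) : Mechanism A₁ A₂ J where
  τ _ := T
  isStoppingTime := isStoppingTime_const _ T
  f x := F (truncate T x)
  measurable_f := by
    rw [IsStoppingTime.measurableSpace_const]
    exact fun u _ => ⟨F ⁻¹' u, (Set.toFinite _).measurableSet, rfl⟩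

section Mechanism

variable {A₁ A₂ J : Type*} [MeasurableSpace A₁] [MeasurableSpace A₂]
  [Finite A₁] [Finite A₂] [MeasurableSingletonClass A₁] [MeasurableSingletonClass A₂]

lemma fixedLengthMechanism_hasLengthAtMost (T : ℕ) (F : FinHistory A₁ A₂ T → J) :
    (fixedLengthMechanism T F).HasLengthAtMost T := by
  intro σ₁ σ₂
  have h : {h : InfHistory A₁ A₂ | (fixedLengthMechanism T F).τ h ≤ (T : WithTop ℕ)} = Set.univ :=
    Set.eq_univ_of_forall fun _ => le_refl (T : WithTop ℕ)
  rw [h, measure_univ]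

lemma fixedLengthMechanism_outcomeProb (T : ℕ) (F : FinHistory A₁ A₂ T → J)
    (σ₁ : Strategy A₁ A₂ A₁) (σ₂ : Strategy A₁ A₂ A₂) (j : J) :
    (fixedLengthMechanism T F).outcomeProb σ₁ σ₂ j
      = ∫ x, Set.indicator {j} (1 : J → ℝ) (F (truncate T x)) ∂(playMeasure σ₁ σ₂) := by
  have hm : MeasurableSet {x : InfHistory A₁ A₂ | F (truncate T x) = j} :=
    measurable_truncate T (Set.toFinite (F ⁻¹' {j})).measurableSet
  exact (integral_indicator_one hm).symm

/-- Selecting an outcome of largest weight implements the mean of the weights, with an error of at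
most their mean impurity. -/
lemma fixedLengthMechanism_implements [Fintype J] {T : ℕ} {X : FinHistory A₁ A₂ T → J → ℝ}
    (hX : ∀ h, X h ∈ stdSimplex ℝ J) {F : FinHistory A₁ A₂ T → J}
    (hF : ∀ h k, X h k ≤ X h (F h)) {σ₁ : Strategy A₁ A₂ A₁} {σ₂ : Strategy A₁ A₂ A₂} {ν : PMF J}
    (hν : ∀ j, ∫ x, X (truncate T x) j ∂(playMeasure σ₁ σ₂) = (ν j).toReal) {ε : ℝ} (hε : 0 ≤ ε)
    (hW : ∫ x, giniImpurity (X (truncate T x)) ∂(playMeasure σ₁ σ₂) ≤ ε) :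
    (fixedLengthMechanism T F).Implements σ₁ σ₂ ν ε := by
  refine (pi_norm_le_iff_of_nonneg hε).2 fun j => ?_
  rw [Pi.sub_apply, fixedLengthMechanism_outcomeProb, ← hν, Real.norm_eq_abs,
    ← integral_sub (integrable_truncate σ₁ σ₂ fun h => Set.indicator {j} (1 : J → ℝ) (F h))
      (integrable_truncate σ₁ σ₂ fun h => X h j)]
  refine (abs_integral_le_integral_abs).trans (le_trans ?_ hW)
  exact integral_mono
    (integrable_truncate σ₁ σ₂ fun h => |Set.indicator {j} (1 : J → ℝ) (F h) - X h j|)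
    (integrable_truncate σ₁ σ₂ fun h => giniImpurity (X h))
    fun x => abs_indicator_sub_le (hX _) (hF _) j

end Mechanism

/-! ### The shock -/

section Shock

variable {A : Type*}

/-- The indicator of the letter `a₀`, centred under the distribution `p`. -/
noncomputable def centeredIndicator (p : PMF A) (a₀ a : A) : ℝ :=
  Set.indicator {a₀} 1 a - (p a₀).toReal

lemma abs_centeredIndicator_le_one (p : PMF A) (a₀ a : A) : |centeredIndicator p a₀ a| ≤ 1 := by
  have h1 : (p a₀).toReal ≤ 1 :=
    ENNReal.toReal_le_of_le_ofReal zero_le_one (by simpa using p.coe_le_one a₀)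
  have h0 : 0 ≤ (p a₀).toReal := ENNReal.toReal_nonneg
  unfold centeredIndicator
  rw [abs_le]
  by_cases h : a = a₀ <;> simp only [h, Set.mem_singleton_iff, Set.indicator, if_true, if_false,
    Pi.one_apply] <;> constructor <;> linarith

lemma centeredIndicator_ne_zero [Nontrivial A] {p : PMF A} (hp : ∀ a, 0 < p a) (a₀ a : A) :
    centeredIndicator p a₀ a ≠ 0 := by
  have h0 : (p a₀).toReal ≠ 0 := ENNReal.toReal_ne_zero.2 ⟨(hp a₀).ne', p.apply_ne_top a₀⟩
  have h1 : (p a₀).toReal ≠ 1 := by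
    intro h
    have h2 : p a₀ = 1 := (ENNReal.toReal_eq_one_iff _).1 h
    obtain ⟨b, hb⟩ := exists_ne a₀
    have h3 : b ∈ p.support := (hp b).ne'
    rw [(p.apply_eq_one_iff a₀).1 h2] at h3
    exact hb h3
  unfold centeredIndicator
  by_cases h : a = a₀
  · simpa [h, sub_eq_zero] using h1.symm
  · simpa [h] using h0

lemma integral_centeredIndicator [Finite A] [MeasurableSpace A] [MeasurableSingletonClass A]
    (p : PMF A) (a₀ : A) : ∫ a, centeredIndicator p a₀ a ∂p.toMeasure = 0 := by
  unfold centeredIndicator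
  rw [integral_sub .of_finite .of_finite, integral_indicator_one (measurableSet_singleton a₀),
    Measure.real, p.toMeasure_apply_singleton a₀ (measurableSet_singleton a₀)]
  simp

end Shock

end ControlledLottery

open ControlledLottery in
theorem theorem1 {A₁ A₂ J : Type*}
    [Finite A₁] [Finite A₂] [Fintype J] [Nontrivial A₁] [Nontrivial A₂] [Nontrivial J]
    [MeasurableSpace A₁] [MeasurableSpace A₂]
    [MeasurableSingletonClass A₁] [MeasurableSingletonClass A₂]
    (σ₁ : Strategy A₁ A₂ A₁) (σ₂ : Strategy A₁ A₂ A₂)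
    (hσ₁ : σ₁.IsStationary) (hσ₂ : σ₂.IsStationary)
    (hσ₁' : σ₁.IsFullyMixed) (hσ₂' : σ₂.IsFullyMixed)
    (ν : PMF J) (ε : ℝ) (hε : 0 < ε) :
    ∃ M : Mechanism A₁ A₂ J, (∃ T : ℕ, M.HasLengthAtMost T) ∧
      M.StronglyImplements σ₁ σ₂ ν ε := by
  obtain ⟨p, hp⟩ := hσ₁
  obtain ⟨q, hq⟩ := hσ₂
  obtain ⟨a₀⟩ : Nonempty A₁ := inferInstance
  obtain ⟨b₀⟩ : Nonempty A₂ := inferInstance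
  have hp' : ∀ a, 0 < p a := fun a => hp 0 Fin.elim0 ▸ hσ₁' 0 Fin.elim0 a
  have hq' : ∀ b, 0 < q b := fun b => hq 0 Fin.elim0 ▸ hσ₂' 0 Fin.elim0 b
  set s : A₁ × A₂ → ℝ := fun a => centeredIndicator p a₀ a.1 * centeredIndicator q b₀ a.2 with hsdef
  have hs : ∀ a, |s a| ≤ 1 := fun a => by
    rw [hsdef, abs_mul]
    exact mul_le_one₀ (abs_centeredIndicator_le_one p a₀ _) (abs_nonneg _)
      (abs_centeredIndicator_le_one q b₀ _)
  obtain ⟨a, ha⟩ := Finite.exists_min fun a => s a ^ 2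
  have hm0 : 0 < s a ^ 2 := sq_pos_of_ne_zero (mul_ne_zero
    (centeredIndicator_ne_zero hp' a₀ _) (centeredIndicator_ne_zero hq' b₀ _))
  obtain ⟨g, δ, hδ0, hg, hδ⟩ := exists_separated_Icc J
  have hκ : 0 < s a ^ 2 * (δ / 2) ^ 2 / Fintype.card J := by
    have : 0 < Fintype.card J := Fintype.card_pos
    positivity
  obtain ⟨T, hT⟩ := exists_forall_le_of_sq_decrease hκ hε
  set x₀ : J → ℝ := fun j => (ν j).toReal with hx₀def
  have hx₀ : x₀ ∈ stdSimplex ℝ J := by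
    refine ⟨fun j => ENNReal.toReal_nonneg, ?_⟩
    rw [hx₀def, ← ENNReal.toReal_sum fun j _ => ν.apply_ne_top j,
      (tsum_fintype _).symm.trans ν.tsum_coe, ENNReal.toReal_one]
  choose F hF using fun h : FinHistory A₁ A₂ T => Finite.exists_max (weights g s x₀ T h)
  -- A unilateral deviation enters only through the hypothesis that the shock has mean zero.
  have main : ∀ (τ₁ : Strategy A₁ A₂ A₁) (τ₂ : Strategy A₁ A₂ A₂),
      (∀ t h, ∫ a, s a ∂(stageLaw τ₁ τ₂ t h) = 0) →
      (fixedLengthMechanism T F).Implements τ₁ τ₂ ν ε := fun τ₁ τ₂ h0 => by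
    refine fixedLengthMechanism_implements (weights_mem_stdSimplex hg hs hx₀ T) hF
      (fun j => integral_weights h0 T j) hε.le ?_
    refine hT (fun t => ∫ x, giniImpurity (weights g s x₀ t (truncate t x)) ∂(playMeasure τ₁ τ₂))
      ?_ fun t => integral_giniImpurity_weights_succ_le h0 hs ha hm0.le hδ0.le hg hδ hx₀ t
    simpa [weights] using giniImpurity_le_one x₀
  refine ⟨fixedLengthMechanism T F, ⟨T, fixedLengthMechanism_hasLengthAtMost T F⟩,
    fun τ₁ => main τ₁ σ₂ fun t h => ?_, fun τ₂ => main σ₁ τ₂ fun t h => ?_⟩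
  · rw [stageLaw, integral_prod_mul, hq, integral_centeredIndicator, mul_zero]
  · rw [stageLaw, integral_prod_mul, hp, integral_centeredIndicator, zero_mul]
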